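/- Let $H$, $U$, $U_1$, $U_2$ be (real or complex) Hilbert spaces, and let $A$ be a linear operator in $H$ satisfying one of the following two conditions: (i) $A:\mathscr D(A)\subset H\to H$ is self-adjoint, positive definite ($\langle Ax,x\rangle>0$ for all $0\neq x\in\mathscr D(A)$) and has compact resolvent; or (ii) $H$ is finite-dimensional and $A:H\to H$ is an arbitrary linear map. Let $B\in\mathscr L(U,H)$, let $\pi:U_1\times U_2\to U$ be a linear isomorphism, and let $B_1\in\mathscr L(U_1,H)$, $B_2\in\mathscr L(U_2,H)$ be such that $B\pi(u_1,u_2)=B_1u_1+B_2u_2$ for all $(u_1,u_2)\in U_1\times U_2$. Let $T>0$. For $f\in L^2(0,T;H)$ and $y_0\in H$, the solution of $y'+Ay=f$ on $(0,T)$, $y(0)=y_0$, is the function $y\in C([0,T];H)$ with $y(0)=y_0$ such that $$\langle y(t),\varphi\rangle_H=\langle y_0,\varphi\rangle_H+\int_0^t\big(\langle f(s),\varphi\rangle_H-\langle y(s),A^*\varphi\rangle_H\big)\,ds\qquad\text{for all }\varphi\in\mathscr D(A^*),\ t\in[0,T].$$ Assume that the system $y'+Ay=Bu$, $y(0)=y_0$,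 is approximately controllable at time $T$: for every $y_0\in H$ and every $\varepsilon>0$ there exists $u\in L^2(0,T;U)$ such that the solution satisfies $\|y(T)\|_H\le\varepsilon$. Then for every $\varepsilon>0$ and every $y_0\in H$ there exist controls $u_1\in L^2(0,T;U_1)$ and $u_2\in L^2(0,T;U_2)$ which are switching, i.e. $\|u_1(t)\|_{U_1}\|u_2(t)\|_{U_2}=0$ for almost every $t\in(0,T)$, and such that the solution $y$ of $y'+Ay=B_1u_1+B_2u_2$ on $(0,T)$, $y(0)=y_0$, satisfies $\|y(T)\|_H\le\varepsilon$. -/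

import Mathlib

open MeasureTheory

namespace SwitchingControl

variable {𝕜 H : Type*} [RCLike 𝕜] [NormedAddCommGroup H] [InnerProductSpace 𝕜 H]

/-- The unbounded operator `A` is positive definite: `⟪A x, x⟫ > 0` for all `x ≠ 0` in its domain. -/
def IsPositiveDefinite (A : H →ₗ.[𝕜] H) : Prop :=
  ∀ x : A.domain, (x : H) ≠ 0 → 0 < RCLike.re (inner 𝕜 (A x) (x : H))

/-- `R` is the resolvent `(lam - A)⁻¹`: it maps `H` into the domain of `A`, and it is a
right and a left inverse of `lam - A`. -/
def IsResolventAt (A : H →ₗ.[𝕜] H) (lam : 𝕜) (R : H →L[𝕜] H) : Prop :=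
  (∀ x : H, ∃ h : R x ∈ A.domain, lam • R x - A ⟨R x, h⟩ = x) ∧
    ∀ x : A.domain, R (lam • (x : H) - A x) = x

/-- `A` has compact resolvent: some scalar belongs to its resolvent set, with a compact resolvent
operator there. -/
def HasCompactResolvent (A : H →ₗ.[𝕜] H) : Prop :=
  ∃ (lam : 𝕜) (R : H →L[𝕜] H), IsResolventAt A lam R ∧ IsCompactOperator R

/-- Membership in `L²(0,T;E)`. -/
def IsL2Control {E : Type*} [NormedAddCommGroup E] (T : ℝ) (u : ℝ → E) : Prop :=
  MemLp u 2 (volume.restrict (Set.Ioo 0 T))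

/-- `y` is the (weak, equivalently mild) solution on `[0,T]` of
`y' + A y = f`, `y(0) = y₀`: it is continuous with values in `H`, and for every `φ` in the domain
of `A*` the function `t ↦ ⟪φ, y(t)⟫` satisfies the equation tested against `φ`, in integrated
form. -/
structure IsSolution [CompleteSpace H] (A : H →ₗ.[𝕜] H) (T : ℝ) (f : ℝ → H) (y₀ : H)
    (y : ℝ → H) : Prop where
  continuousOn : ContinuousOn y (Set.Icc 0 T)
  initial : y 0 = y₀
  weak : ∀ φ : A.adjoint.domain, ∀ t ∈ Set.Icc 0 T,
    inner 𝕜 (φ : H) (y t) = inner 𝕜 (φ : H) y₀ +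
      ∫ s in (0 : ℝ)..t, (inner 𝕜 (φ : H) (f s) - inner 𝕜 (A.adjoint φ) (y s))

/-- The system `y' + A y = B u`, `y(0) = y₀` is approximately controllable at time `T`. -/
def IsApproxControllable {U : Type*} [NormedAddCommGroup U] [InnerProductSpace 𝕜 U]
    [CompleteSpace H] (A : H →ₗ.[𝕜] H) (B : U →L[𝕜] H) (T : ℝ) : Prop :=
  ∀ y₀ : H, ∀ ε : ℝ, 0 < ε → ∃ u : ℝ → U, IsL2Control T u ∧
    ∃ y : ℝ → H, IsSolution A T (fun t => B (u t)) y₀ y ∧ ‖y T‖ ≤ ε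

end SwitchingControl

/-!
The two controls can switch at a time chosen in advance: `u₁` acts on `(0, T / 2)` only and `u₂` on
`(T / 2, T)` only. With the switching time fixed, the states reachable from `0` form a linear
subspace `K` of `H` (`IsPropagator.reachable`), and the theorem says that `-S(T) y₀` lies in the
closure of `K`, where `S(t) = exp (-t A)`. So let `φ` be orthogonal to `K`. Testing with controls of
the form `c(t) v` shows that `⟪φ, S(t) B₁ v⟫` vanishes for `t ∈ (T / 2, T)` and `⟪φ, S(t) B₂ v⟫` for
`t ∈ (0, T / 2)`. Both functions are real-analytic on `(0, ∞)`, hence both vanish there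
(`IsPropagator.inner_eq_zero_of_mem_orthogonal`). As the ranges of `B₁` and `B₂` together span that
of `B`, every control `u` of the original system yields `⟪φ, y(T)⟫ = ⟪φ, S(T) y₀⟫`, and approximate
controllability forces `⟪φ, S(T) y₀⟫ = 0` (`IsPropagator.exists_switching_controls`).

What the argument needs from the semigroup is collected in `IsPropagator`: it yields Duhamel's
formula for the weak solution, by Fubini's theorem, and uniqueness. For a bounded generator
the propagator is the operator exponential (`isPropagator_exp`). For a positive definite
self-adjoint `A` with compact resolvent it is diagonal in a Hilbert basis of eigenvectors
(`isPropagator_diagonalDecay`); the basis comes from the spectral theorem for the compact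
operator `(1 + A)⁻¹`, and the analyticity from the fact that `⟪φ, S(t) x⟫` is a series
`∑ aᵢ exp (-μᵢ t)` with `∑ |aᵢ| < ∞`.
-/

namespace SwitchingControl

open Set Filter Topology Module.End

universe u v

/-! ### Propagators and Duhamel's formula -/

section

variable {𝕜 H : Type*} [RCLike 𝕜] [NormedAddCommGroup H] [InnerProductSpace 𝕜 H]

/-- `S` is the solution semigroup of `y' + A y = 0` on `[0, ∞)`, recorded through the properties
needed for approximate controllability: the orbits solve the equation weakly, weak solutions are
unique, and the coefficients `t ↦ ⟪φ, S t x⟫` satisfy unique continuation on `(0, ∞)`, a substitute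
for their real-analyticity. The values `S t` with `t < 0` only enter through joint continuity. -/
structure IsPropagator [CompleteSpace H] (A : H →ₗ.[𝕜] H) (S : ℝ → H →L[𝕜] H) : Prop where
  continuous : Continuous fun p : ℝ × H => S p.1 p.2
  bounded : ∀ T : ℝ, ∃ M : ℝ, ∀ t ∈ Icc 0 T, ‖S t‖ ≤ M
  zero : S 0 = ContinuousLinearMap.id 𝕜 H
  weak : ∀ (φ : A.adjoint.domain) (x : H) (t : ℝ), 0 ≤ t →
    inner 𝕜 (φ : H) (S t x) =
      inner 𝕜 (φ : H) x - ∫ s in (0 : ℝ)..t, inner 𝕜 (A.adjoint φ) (S s x)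
  unique : ∀ (T : ℝ) (w : ℝ → H), ContinuousOn w (Icc 0 T) →
    (∀ φ : A.adjoint.domain, ∀ t ∈ Icc 0 T,
      inner 𝕜 (φ : H) (w t) = -∫ s in (0 : ℝ)..t, inner 𝕜 (A.adjoint φ) (w s)) →
    ∀ t ∈ Icc 0 T, w t = 0
  continuation : ∀ (φ x : H) (a b : ℝ), 0 ≤ a → a < b →
    (∀ t ∈ Ioo a b, inner 𝕜 φ (S t x) = 0) → ∀ t : ℝ, 0 < t → inner 𝕜 φ (S t x) = 0

namespace IsPropagator

variable [CompleteSpace H] {A : H →ₗ.[𝕜] H} {S : ℝ → H →L[𝕜] H}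

theorem aestronglyMeasurable_comp (hS : IsPropagator A S) {α : Type*} [MeasurableSpace α]
    {μ : Measure α} {τ : α → ℝ} {f : α → H} (hτ : Measurable τ) (hf : AEStronglyMeasurable f μ) :
    AEStronglyMeasurable (fun a => S (τ a) (f a)) μ :=
  hS.continuous.comp_aestronglyMeasurable (hτ.aestronglyMeasurable.prodMk hf)

theorem integrableOn_convolution (hS : IsPropagator A S) {T : ℝ} {f : ℝ → H}
    (hf : IntegrableOn f (Ioc 0 T)) {t : ℝ} (ht : t ∈ Icc 0 T) :
    IntegrableOn (fun s => S (t - s) (f s)) (Ioc 0 t) := by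
  obtain ⟨M, hM⟩ := hS.bounded T
  have hft : IntegrableOn f (Ioc 0 t) := hf.mono_set (Ioc_subset_Ioc_right ht.2)
  refine (hft.norm.const_mul M).mono'
    (hS.aestronglyMeasurable_comp (by fun_prop) hft.aestronglyMeasurable) ?_
  filter_upwards [ae_restrict_mem measurableSet_Ioc] with s hs
  have := hM (t - s) ⟨by linarith [hs.2], by linarith [hs.1, ht.2]⟩
  exact (ContinuousLinearMap.le_opNorm _ _).trans (by gcongr)

theorem eq_of_isSolution (hS : IsPropagator A S) {T : ℝ} {f : ℝ → H}
    (hf : IntegrableOn f (Ioc 0 T)) {y₀ : H} {y z : ℝ → H} (hy : IsSolution A T f y₀ y)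
    (hz : IsSolution A T f y₀ z) {t : ℝ} (ht : t ∈ Icc 0 T) : y t = z t := by
  refine sub_eq_zero.1
    (hS.unique T (fun t => y t - z t) (hy.continuousOn.sub hz.continuousOn) ?_ t ht)
  intro φ t ht
  have hft : IntegrableOn f (Ioc 0 t) := hf.mono_set (Ioc_subset_Ioc_right ht.2)
  have hf' : IntervalIntegrable (fun s => inner 𝕜 (φ : H) (f s)) volume 0 t :=
    (intervalIntegrable_iff_integrableOn_Ioc_of_le ht.1).2 (hft.const_inner _)
  have hc : ∀ {y : ℝ → H}, ContinuousOn y (Icc 0 T) →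
      IntervalIntegrable (fun s => inner 𝕜 (A.adjoint φ) (y s)) volume 0 t := by
    intro y hy
    refine ContinuousOn.intervalIntegrable ?_
    rw [uIcc_of_le ht.1]
    exact continuousOn_const.inner (hy.mono (Icc_subset_Icc_right ht.2))
  simp only [inner_sub_right]
  rw [hy.weak φ t ht, hz.weak φ t ht, intervalIntegral.integral_sub hf' (hc hy.continuousOn),
    intervalIntegral.integral_sub hf' (hc hz.continuousOn),
    intervalIntegral.integral_sub (hc hy.continuousOn) (hc hz.continuousOn)]
  ring

variable [NormedSpace ℝ H]

theorem continuousOn_convolution (hS : IsPropagator A S) {T : ℝ} {f : ℝ → H}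
    (hf : IntegrableOn f (Ioc 0 T)) :
    ContinuousOn (fun t => ∫ s in (0 : ℝ)..t, S (t - s) (f s)) (Icc 0 T) := by
  obtain ⟨M, hM⟩ := hS.bounded T
  have hM0 : ∀ t ∈ Icc 0 T, 0 ≤ M := fun t ht => (norm_nonneg _).trans (hM t ht)
  have key : ContinuousOn
      (fun t => ∫ s in Ioc 0 T, (Iic t).indicator (fun s => S (t - s) (f s)) s) (Icc 0 T) := by
    intro t₀ ht₀
    refine continuousWithinAt_of_dominated (bound := fun s => M * ‖f s‖) ?_ ?_
      (hf.norm.const_mul M) ?_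
    · exact Eventually.of_forall fun t => (hS.aestronglyMeasurable_comp (by fun_prop)
        hf.aestronglyMeasurable).indicator measurableSet_Iic
    · filter_upwards [self_mem_nhdsWithin] with t ht
      filter_upwards [ae_restrict_mem measurableSet_Ioc] with s hs
      by_cases hst : s ∈ Iic t
      · rw [indicator_of_mem hst]
        have := hM (t - s) ⟨by linarith [mem_Iic.1 hst], by linarith [hs.1, ht.2]⟩
        exact (ContinuousLinearMap.le_opNorm _ _).trans (by gcongr)
      · rw [indicator_of_notMem hst, norm_zero]
        exact mul_nonneg (hM0 t ht) (norm_nonneg _)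
    · -- The integrand is continuous in `t` at `t₀` except at the single point `s = t₀`.
      have hne : ∀ᵐ s ∂(volume.restrict (Ioc 0 T)), s ≠ t₀ :=
        ae_restrict_of_ae (Measure.ae_ne volume t₀)
      filter_upwards [hne] with s hs
      refine ContinuousAt.continuousWithinAt ?_
      rcases lt_or_gt_of_ne hs with h | h
      · have hev : (fun t => (Iic t).indicator (fun s => S (t - s) (f s)) s) =ᶠ[𝓝 t₀]
            fun t => S (t - s) (f s) := by
          filter_upwards [lt_mem_nhds h] with t ht
          exact indicator_of_mem (mem_Iic.2 (le_of_lt ht)) _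
        refine ContinuousAt.congr ?_ hev.symm
        exact (hS.continuous.comp (by fun_prop : Continuous fun t : ℝ => (t - s, f s))).continuousAt
      · have hev : (fun t => (Iic t).indicator (fun s => S (t - s) (f s)) s) =ᶠ[𝓝 t₀]
            fun _ => 0 := by
          filter_upwards [gt_mem_nhds h] with t ht
          exact indicator_of_notMem (fun h' => absurd (mem_Iic.1 h') (not_le.2 ht)) _
        exact continuousAt_const.congr hev.symm
  refine key.congr fun t ht => ?_
  have h2 : Ioc 0 T ∩ Iic t = Ioc 0 t := by
    ext s; simp only [mem_inter_iff, mem_Ioc, mem_Iic]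
    exact ⟨fun h => ⟨h.1.1, h.2⟩, fun h => ⟨⟨h.1, h.2.trans ht.2⟩, h.2⟩⟩
  simp only []
  rw [intervalIntegral.integral_of_le ht.1, setIntegral_indicator measurableSet_Iic, h2]

theorem inner_convolution (hS : IsPropagator A S) {T : ℝ} {f : ℝ → H}
    (hf : IntegrableOn f (Ioc 0 T)) (φ : H) {t : ℝ} (ht : t ∈ Icc 0 T) :
    inner 𝕜 φ (∫ s in (0 : ℝ)..t, S (t - s) (f s)) =
      ∫ s in Ioc 0 t, inner 𝕜 φ (S (t - s) (f s)) := by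
  rw [intervalIntegral.integral_of_le ht.1]
  exact (integral_inner (hS.integrableOn_convolution hf ht) φ).symm

/-- Fubini's theorem on the triangle `0 < s ≤ r ≤ t`, for the coefficient of the convolution
`S * f` along `ψ`. -/
theorem integral_inner_convolution (hS : IsPropagator A S) {T : ℝ} {f : ℝ → H}
    (hf : IntegrableOn f (Ioc 0 T)) (ψ : H) {t : ℝ} (ht : t ∈ Icc 0 T) :
    IntegrableOn (fun s => ∫ r in (0 : ℝ)..(t - s), inner 𝕜 ψ (S r (f s))) (Ioc 0 t) ∧
    ∫ s in Ioc 0 t, ∫ r in (0 : ℝ)..(t - s), inner 𝕜 ψ (S r (f s)) =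
      ∫ r in (0 : ℝ)..t, inner 𝕜 ψ (∫ s in (0 : ℝ)..r, S (r - s) (f s)) := by
  obtain ⟨M, hM⟩ := hS.bounded T
  have hft : IntegrableOn f (Ioc 0 t) := hf.mono_set (Ioc_subset_Ioc_right ht.2)
  set μ : Measure ℝ := volume.restrict (Ioc 0 t) with hμ
  set G : ℝ × ℝ → 𝕜 := {p : ℝ × ℝ | p.1 ≤ p.2}.indicator
    (fun p => inner 𝕜 ψ (S (p.2 - p.1) (f p.1))) with hG
  have hmeas : MeasurableSet {p : ℝ × ℝ | p.1 ≤ p.2} := measurableSet_le measurable_fst measurable_snd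
  have hsq : ∀ᵐ p ∂(μ.prod μ), p ∈ Ioc 0 t ×ˢ Ioc 0 t := by
    rw [hμ, Measure.prod_restrict]
    exact ae_restrict_mem (measurableSet_Ioc.prod measurableSet_Ioc)
  have hGint : Integrable G (μ.prod μ) := by
    have hb : Integrable (fun p : ℝ × ℝ => ‖ψ‖ * (M * ‖f p.1‖)) (μ.prod μ) :=
      ((hft.norm.const_mul M).const_mul ‖ψ‖).comp_fst μ
    refine hb.mono' ?_ ?_
    · refine AEStronglyMeasurable.indicator ?_ hmeas
      exact AEStronglyMeasurable.inner aestronglyMeasurable_const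
        (hS.aestronglyMeasurable_comp (by fun_prop) hft.aestronglyMeasurable.comp_fst)
    · filter_upwards [hsq] with p hp
      have h1 := hp.1
      have h2 := hp.2
      have hM0 : 0 ≤ M := (norm_nonneg _).trans (hM t ht)
      by_cases hst : p ∈ {p : ℝ × ℝ | p.1 ≤ p.2}
      · rw [hG, indicator_of_mem hst]
        have := hM (p.2 - p.1) ⟨by linarith [show p.1 ≤ p.2 from hst],
          by linarith [h1.1, h2.2, ht.2]⟩
        refine (norm_inner_le_norm _ _).trans ?_
        gcongr
        exact (ContinuousLinearMap.le_opNorm _ _).trans (by gcongr)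
      · rw [hG, indicator_of_notMem hst, norm_zero]
        positivity
  have hleft : ∀ s ∈ Ioc 0 t, ∫ r, G (s, r) ∂μ = ∫ r in (0 : ℝ)..(t - s), inner 𝕜 ψ (S r (f s)) := by
    intro s hs
    have h1 : (fun r => G (s, r)) =
        (Ici s).indicator (fun r => inner 𝕜 ψ (S (r - s) (f s))) := by
      ext r; rfl
    have h2 : Ioc 0 t ∩ Ici s = Icc s t := by
      ext r; simp only [mem_inter_iff, mem_Ioc, mem_Ici, mem_Icc]
      exact ⟨fun h => ⟨h.2, h.1.2⟩, fun h => ⟨⟨hs.1.trans_le h.1, h.2⟩, h.1⟩⟩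
    rw [h1, hμ, setIntegral_indicator measurableSet_Ici, h2, integral_Icc_eq_integral_Ioc,
      ← intervalIntegral.integral_of_le hs.2,
      intervalIntegral.integral_comp_sub_right (fun r => inner 𝕜 ψ (S r (f s))) s, sub_self]
  have hright : ∀ r ∈ Ioc 0 t, ∫ s, G (s, r) ∂μ =
      inner 𝕜 ψ (∫ s in (0 : ℝ)..r, S (r - s) (f s)) := by
    intro r hr
    have h1 : (fun s => G (s, r)) =
        (Iic r).indicator (fun s => inner 𝕜 ψ (S (r - s) (f s))) := by
      ext s; rfl
    have h2 : Ioc 0 t ∩ Iic r = Ioc 0 r := by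
      ext s; simp only [mem_inter_iff, mem_Ioc, mem_Iic]
      exact ⟨fun h => ⟨h.1.1, h.2⟩, fun h => ⟨⟨h.1, h.2.trans hr.2⟩, h.2⟩⟩
    rw [h1, hμ, setIntegral_indicator measurableSet_Iic, h2,
      hS.inner_convolution hf ψ ⟨hr.1.le, hr.2.trans ht.2⟩]
  refine ⟨?_, ?_⟩
  · exact hGint.integral_prod_left.congr
      ((ae_restrict_mem measurableSet_Ioc).mono fun s hs => hleft s hs)
  · rw [intervalIntegral.integral_of_le ht.1, ← setIntegral_congr_fun measurableSet_Ioc hleft,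
      ← setIntegral_congr_fun measurableSet_Ioc hright]
    exact integral_integral_swap (f := fun s r => G (s, r)) hGint

/-- Duhamel's formula gives a weak solution. -/
theorem isSolution_duhamel (hS : IsPropagator A S) {T : ℝ} {f : ℝ → H}
    (hf : IntegrableOn f (Ioc 0 T)) (y₀ : H) :
    IsSolution A T f y₀ (fun t => S t y₀ + ∫ s in (0 : ℝ)..t, S (t - s) (f s)) where
  continuousOn := by
    have h1 : Continuous fun t => S t y₀ :=
      hS.continuous.comp (by fun_prop : Continuous fun t : ℝ => (t, y₀))
    exact h1.continuousOn.add (hS.continuousOn_convolution hf)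
  initial := by simp [hS.zero]
  weak := by
    intro φ t ht
    obtain ⟨hint, hswap⟩ := hS.integral_inner_convolution hf (A.adjoint φ) ht
    have hft : IntegrableOn f (Ioc 0 t) := hf.mono_set (Ioc_subset_Ioc_right ht.2)
    have hconv : inner 𝕜 (φ : H) (∫ s in (0 : ℝ)..t, S (t - s) (f s)) =
        (∫ s in (0 : ℝ)..t, inner 𝕜 (φ : H) (f s)) -
          ∫ r in (0 : ℝ)..t, inner 𝕜 (A.adjoint φ) (∫ s in (0 : ℝ)..r, S (r - s) (f s)) := by
      rw [hS.inner_convolution hf _ ht, ← hswap, intervalIntegral.integral_of_le ht.1,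
        ← integral_sub (hft.const_inner _) hint]
      exact setIntegral_congr_fun measurableSet_Ioc fun s hs =>
        hS.weak φ (f s) (t - s) (sub_nonneg.2 hs.2)
    have h1 : IntervalIntegrable (fun s => inner 𝕜 (A.adjoint φ) (S s y₀)) volume 0 t := by
      refine Continuous.intervalIntegrable ?_ _ _
      exact continuous_const.inner
        (hS.continuous.comp (by fun_prop : Continuous fun t : ℝ => (t, y₀)))
    have h2 : IntervalIntegrable (fun r => inner 𝕜 (A.adjoint φ)
        (∫ s in (0 : ℝ)..r, S (r - s) (f s))) volume 0 t := by
      refine ContinuousOn.intervalIntegrable ?_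
      rw [uIcc_of_le ht.1]
      exact continuousOn_const.inner
        ((hS.continuousOn_convolution hf).mono (Icc_subset_Icc_right ht.2))
    have h3 : IntervalIntegrable (fun s => inner 𝕜 (φ : H) (f s)) volume 0 t :=
      (intervalIntegrable_iff_integrableOn_Ioc_of_le ht.1).2 (hft.const_inner _)
    simp only [inner_add_right]
    rw [intervalIntegral.integral_sub h3 (h1.add h2), intervalIntegral.integral_add h1 h2, hconv,
      hS.weak φ y₀ t ht.1]
    ring

end IsPropagator

end

/-! ### Switching at a fixed time -/

section

variable {𝕜 H U U₁ U₂ : Type*} [RCLike 𝕜] [NormedAddCommGroup H] [InnerProductSpace 𝕜 H]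
  [NormedAddCommGroup U] [InnerProductSpace 𝕜 U]
  [NormedAddCommGroup U₁] [InnerProductSpace 𝕜 U₁] [NormedAddCommGroup U₂] [InnerProductSpace 𝕜 U₂]

theorem IsL2Control.integrableOn_comp {T : ℝ} {u : ℝ → U} (hu : IsL2Control T u) (B : U →L[𝕜] H) :
    IntegrableOn (fun t => B (u t)) (Ioc 0 T) := by
  rw [integrableOn_Ioc_iff_integrableOn_Ioo]
  exact (B.comp_memLp' hu).integrable one_le_two

theorem isL2Control_indicator_smul {T : ℝ} {c : ℝ → 𝕜} (hc : Continuous c) (v : U) {E : Set ℝ}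
    (hE : MeasurableSet E) : IsL2Control T (E.indicator fun t => c t • v) := by
  refine MemLp.indicator hE ?_
  have hcont : Continuous fun t => c t • v := hc.smul continuous_const
  obtain ⟨C, hC⟩ := (isCompact_Icc (a := (0 : ℝ)) (b := T)).exists_bound_of_continuousOn
    hcont.continuousOn
  refine MemLp.of_bound hcont.aestronglyMeasurable C ?_
  filter_upwards [ae_restrict_mem measurableSet_Ioo] with t ht
  exact hC t (Ioo_subset_Icc_self ht)

theorem inner_indicator_smul {S : ℝ → H →L[𝕜] H} (φ : H) (B : U →L[𝕜] H) (T : ℝ) (E : Set ℝ)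
    (c : ℝ → 𝕜) (v : U) (s : ℝ) : inner 𝕜 φ (S (T - s) (B (E.indicator (fun t => c t • v) s))) =
      E.indicator (fun s => c s * inner 𝕜 φ (S (T - s) (B v))) s := by
  by_cases hs : s ∈ E <;> simp [hs, inner_smul_right]

namespace IsPropagator

variable [CompleteSpace H] {A : H →ₗ.[𝕜] H} {S : ℝ → H →L[𝕜] H}

/-- If `s ↦ ⟪φ, S (T - s) x⟫` is orthogonal to every continuous weight on some interval, then
`⟪φ, S t x⟫ = 0` for all `t > 0`. -/
theorem inner_eq_zero_of_integral_eq_zero (hS : IsPropagator A S) {φ x : H} {T a b : ℝ}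
    (hab : a < b) (hb : b ≤ T)
    (h : ∀ c : ℝ → 𝕜, Continuous c →
      ∫ s in Ioo a b, c s * inner 𝕜 φ (S (T - s) x) = 0) :
    ∀ t : ℝ, 0 < t → inner 𝕜 φ (S t x) = 0 := by
  have hg : Continuous fun s => inner 𝕜 φ (S (T - s) x) := continuous_const.inner
    (hS.continuous.comp (by fun_prop : Continuous fun s : ℝ => (T - s, x)))
  -- The conjugate of the function itself is a legitimate weight.
  have h0 := h _ hg.star
  have h1 : ∫ s in Ioo a b, ‖inner 𝕜 φ (S (T - s) x)‖ ^ 2 = 0 := by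
    have : ∀ s, star (inner 𝕜 φ (S (T - s) x)) * inner 𝕜 φ (S (T - s) x) =
        ((‖inner 𝕜 φ (S (T - s) x)‖ ^ 2 : ℝ) : 𝕜) := fun s => by
      rw [← starRingEnd_apply, RCLike.conj_mul]; push_cast; rfl
    simp only [this] at h0
    rw [integral_ofReal] at h0
    exact_mod_cast h0
  have hint : IntegrableOn (fun s => ‖inner 𝕜 φ (S (T - s) x)‖ ^ 2) (Ioo a b) :=
    ((hg.norm.pow 2).continuousOn.integrableOn_Icc).mono_set Ioo_subset_Icc_self
  have h2 := (integral_eq_zero_iff_of_nonneg (fun s => by positivity) hint).1 h1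
  have h3 : EqOn (fun s => ‖inner 𝕜 φ (S (T - s) x)‖ ^ 2) (fun _ => 0) (Ioo a b) :=
    Measure.eqOn_open_of_ae_eq h2 isOpen_Ioo (hg.norm.pow 2).continuousOn continuousOn_const
  refine hS.continuation φ x (T - b) (T - a) (by linarith) (by linarith) fun t ht => ?_
  have := h3 (show T - t ∈ Ioo a b from ⟨by linarith [ht.2], by linarith [ht.1]⟩)
  simpa using this

variable [NormedSpace ℝ H]

/-- The states reachable from `0` at time `T` when the first control acts only at times in `E`, and
the second one only at times outside `E`. With `E` fixed in advance this is a linear subspace. -/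
def reachable (hS : IsPropagator A S) (B₁ : U₁ →L[𝕜] H) (B₂ : U₂ →L[𝕜] H) (T : ℝ) (E : Set ℝ) :
    Submodule 𝕜 H where
  carrier := {z | ∃ (u₁ : ℝ → U₁) (u₂ : ℝ → U₂), IsL2Control T u₁ ∧ IsL2Control T u₂ ∧
    (∀ t ∉ E, u₁ t = 0) ∧ (∀ t ∈ E, u₂ t = 0) ∧
    z = ∫ s in Ioc 0 T, S (T - s) (B₁ (u₁ s) + B₂ (u₂ s))}
  zero_mem' := ⟨0, 0, MemLp.zero, MemLp.zero, by simp, by simp, by simp⟩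
  add_mem' := by
    rintro _ _ ⟨u₁, u₂, h₁, h₂, h₃, h₄, rfl⟩ ⟨v₁, v₂, k₁, k₂, k₃, k₄, rfl⟩
    refine ⟨u₁ + v₁, u₂ + v₂, h₁.add k₁, h₂.add k₂, fun t ht => by simp [h₃ t ht, k₃ t ht],
      fun t ht => by simp [h₄ t ht, k₄ t ht], ?_⟩
    rcases le_or_gt T 0 with hT | hT
    · simp [Ioc_eq_empty hT.not_gt]
    refine (integral_add
      (hS.integrableOn_convolution ((h₁.integrableOn_comp B₁).add (h₂.integrableOn_comp B₂))
        (right_mem_Icc.2 hT.le))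
      (hS.integrableOn_convolution ((k₁.integrableOn_comp B₁).add (k₂.integrableOn_comp B₂))
        (right_mem_Icc.2 hT.le))).symm.trans ?_
    congr 1
    ext s
    simp only [Pi.add_apply, map_add]
    abel
  smul_mem' := by
    rintro c _ ⟨u₁, u₂, h₁, h₂, h₃, h₄, rfl⟩
    refine ⟨c • u₁, c • u₂, h₁.const_smul c, h₂.const_smul c, fun t ht => by simp [h₃ t ht],
      fun t ht => by simp [h₄ t ht], ?_⟩
    rw [← integral_smul]
    simp [smul_add]

/-- The adjoint observation of a vector orthogonal to the reachable space vanishes for both control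
operators at all times, although each control acts during a part of `(0, T)` only: unique
continuation propagates the vanishing from either part. -/
theorem inner_eq_zero_of_mem_orthogonal (hS : IsPropagator A S) {B₁ : U₁ →L[𝕜] H}
    {B₂ : U₂ →L[𝕜] H} {T τ : ℝ} (hτ : τ ∈ Ioo 0 T) {φ : H}
    (hφ : φ ∈ (hS.reachable B₁ B₂ T (Iio τ))ᗮ) :
    (∀ (v : U₁) (t : ℝ), 0 < t → inner 𝕜 φ (S t (B₁ v)) = 0) ∧
      ∀ (v : U₂) (t : ℝ), 0 < t → inner 𝕜 φ (S t (B₂ v)) = 0 := by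
  rw [Submodule.mem_orthogonal'] at hφ
  have hT : T ∈ Icc 0 T := right_mem_Icc.2 (hτ.1.trans hτ.2).le
  constructor
  · intro v
    refine hS.inner_eq_zero_of_integral_eq_zero hτ.1 hτ.2.le fun c hc => ?_
    have hu := isL2Control_indicator_smul (T := T) hc v (measurableSet_Iio (a := τ))
    have hz := hφ _ ⟨(Iio τ).indicator fun t => c t • v, 0, hu, MemLp.zero,
      fun t ht => indicator_of_notMem ht _, fun t _ => rfl, rfl⟩
    simp only [Pi.zero_apply, map_zero, add_zero] at hz
    rw [← integral_inner (hS.integrableOn_convolution (hu.integrableOn_comp B₁) hT)] at hz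
    simp only [inner_indicator_smul] at hz
    rw [setIntegral_indicator measurableSet_Iio] at hz
    rw [← hz]
    congr 2
    ext s
    simp only [mem_inter_iff, mem_Ioo, mem_Ioc, mem_Iio]
    exact ⟨fun h => ⟨⟨h.1, (h.2.trans hτ.2).le⟩, h.2⟩, fun h => ⟨h.1.1, h.2⟩⟩
  · intro v
    refine hS.inner_eq_zero_of_integral_eq_zero hτ.2 le_rfl fun c hc => ?_
    have hu := isL2Control_indicator_smul (T := T) hc v (measurableSet_Ici (a := τ))
    have hz := hφ _ ⟨0, (Ici τ).indicator fun t => c t • v, MemLp.zero, hu, fun t _ => rfl,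
      fun t ht => indicator_of_notMem (fun h => absurd h (not_le.2 ht)) _, rfl⟩
    simp only [Pi.zero_apply, map_zero, zero_add] at hz
    rw [← integral_inner (hS.integrableOn_convolution (hu.integrableOn_comp B₂) hT)] at hz
    simp only [inner_indicator_smul] at hz
    rw [setIntegral_indicator measurableSet_Ici] at hz
    rw [← hz, ← integral_Icc_eq_integral_Ioo]
    congr 2
    ext s
    simp only [mem_inter_iff, mem_Icc, mem_Ioc, mem_Ici]
    exact ⟨fun h => ⟨⟨hτ.1.trans_le h.1, h.2⟩, h.1⟩, fun h => ⟨h.2, h.1.2⟩⟩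

theorem exists_switching_controls (hS : IsPropagator A S) {B : U →L[𝕜] H} {B₁ : U₁ →L[𝕜] H}
    {B₂ : U₂ →L[𝕜] H} (hB : ∀ u : U, ∃ u₁ u₂, B u = B₁ u₁ + B₂ u₂) {T : ℝ} (hT : 0 < T)
    (hcontr : IsApproxControllable A B T) {ε : ℝ} (hε : 0 < ε) (y₀ : H) :
    ∃ (u₁ : ℝ → U₁) (u₂ : ℝ → U₂), IsL2Control T u₁ ∧ IsL2Control T u₂ ∧
      (∀ t, ‖u₁ t‖ * ‖u₂ t‖ = 0) ∧
      (∃ y : ℝ → H, IsSolution A T (fun t => B₁ (u₁ t) + B₂ (u₂ t)) y₀ y) ∧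
      ∀ y : ℝ → H, IsSolution A T (fun t => B₁ (u₁ t) + B₂ (u₂ t)) y₀ y → ‖y T‖ ≤ ε := by
  have hTmem : T ∈ Icc 0 T := right_mem_Icc.2 hT.le
  -- Since the reachable space is linear, its closure is its double orthogonal complement.
  have hmem : -S T y₀ ∈ (hS.reachable B₁ B₂ T (Iio (T / 2))).topologicalClosure := by
    rw [← Submodule.orthogonal_orthogonal_eq_closure, Submodule.mem_orthogonal]
    intro φ hφ
    obtain ⟨h₁, h₂⟩ := hS.inner_eq_zero_of_mem_orthogonal ⟨by linarith, by linarith⟩ hφ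
    rw [inner_neg_right, neg_eq_zero, ← norm_eq_zero]
    refine le_antisymm (le_of_forall_pos_le_add fun δ hδ => ?_) (norm_nonneg _)
    obtain ⟨u, hu, y, hy, hyT⟩ := hcontr y₀ (δ / (‖φ‖ + 1)) (by positivity)
    have hBu := hu.integrableOn_comp B
    have hrep := hS.eq_of_isSolution hBu hy (hS.isSolution_duhamel hBu y₀) hTmem
    have hzero : inner 𝕜 φ (∫ s in (0 : ℝ)..T, S (T - s) (B (u s))) = 0 := by
      rw [hS.inner_convolution hBu φ hTmem, integral_Ioc_eq_integral_Ioo]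
      refine setIntegral_eq_zero_of_forall_eq_zero fun s hs => ?_
      obtain ⟨v₁, v₂, hv⟩ := hB (u s)
      have hs' : 0 < T - s := sub_pos.2 hs.2
      simp [hv, inner_add_right, h₁ v₁ _ hs', h₂ v₂ _ hs']
    have hval : inner 𝕜 φ (S T y₀) = inner 𝕜 φ (y T) := by
      rw [hrep, inner_add_right, hzero, add_zero]
    rw [hval, zero_add]
    calc ‖inner 𝕜 φ (y T)‖ ≤ ‖φ‖ * ‖y T‖ := norm_inner_le_norm _ _
      _ ≤ (‖φ‖ + 1) * (δ / (‖φ‖ + 1)) := by gcongr; linarith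
      _ = δ := by field_simp
  obtain ⟨z, ⟨u₁, u₂, hu₁, hu₂, h₁, h₂, rfl⟩, hz⟩ := Metric.mem_closure_iff.1 hmem ε hε
  have hf : IntegrableOn (fun t => B₁ (u₁ t) + B₂ (u₂ t)) (Ioc 0 T) :=
    (hu₁.integrableOn_comp B₁).add (hu₂.integrableOn_comp B₂)
  refine ⟨u₁, u₂, hu₁, hu₂, fun t => ?_, ⟨_, hS.isSolution_duhamel hf y₀⟩, fun y hy => ?_⟩
  · by_cases ht : t ∈ Iio (T / 2)
    · simp [h₂ t ht]
    · simp [h₁ t ht]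
  · rw [hS.eq_of_isSolution hf hy (hS.isSolution_duhamel hf y₀) hTmem,
      intervalIntegral.integral_of_le hT.le]
    rw [dist_comm, dist_eq_norm, sub_neg_eq_add, add_comm] at hz
    exact hz.le

end IsPropagator

end

/-! ### Bounded generators -/

section

/-- Grönwall's lemma for a homogeneous linear Volterra equation. -/
theorem eq_zero_of_eq_integral {E : Type*} [NormedAddCommGroup E] [NormedSpace ℝ E]
    [CompleteSpace E] {T K : ℝ} {w g : ℝ → E} (hg : ContinuousOn g (Icc 0 T))
    (hwg : ∀ t ∈ Icc 0 T, w t = ∫ s in (0 : ℝ)..t, g s)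
    (hb : ∀ t ∈ Icc 0 T, ‖g t‖ ≤ K * ‖w t‖) : ∀ t ∈ Icc 0 T, w t = 0 := by
  intro t ht
  have hT : (0 : ℝ) ≤ T := ht.1.trans ht.2
  set G : ℝ → E := IccExtend hT ((Icc 0 T).domRestrict g) with hG
  have hGc : Continuous G := hg.domRestrict.Icc_extend'
  have hGg : ∀ s ∈ Icc 0 T, G s = g s := fun s hs => by rw [hG, IccExtend_of_mem _ _ hs]; rfl
  have hwG : ∀ s ∈ Icc 0 T, w s = ∫ r in (0 : ℝ)..s, G r := fun s hs => by
    rw [hwg s hs]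
    refine intervalIntegral.integral_congr fun r hr => ?_
    rw [uIcc_of_le hs.1] at hr
    exact (hGg r ⟨hr.1, hr.2.trans hs.2⟩).symm
  have hd : ∀ s, HasDerivAt (fun s => ∫ r in (0 : ℝ)..s, G r) (G s) s := fun s =>
    (hGc.integral_hasStrictDerivAt 0 s).hasDerivAt
  rw [hwG t ht]
  refine eq_zero_of_abs_deriv_le_mul_abs_self_of_eq_zero_right (f' := G) (K := K) (a := 0) (b := T)
    (fun s _ => (hd s).continuousAt.continuousWithinAt) (fun s _ => (hd s).hasDerivWithinAt)
    intervalIntegral.integral_same (fun s hs => ?_) t ht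
  have hs' := Ico_subset_Icc_self hs
  rw [← hwG s hs', hGg s hs']
  exact hb s hs'

variable {𝕜 H : Type*} [RCLike 𝕜] [NormedAddCommGroup H] [InnerProductSpace 𝕜 H] [CompleteSpace H]

/-- For a bounded generator the propagator is the operator exponential. The time variable is cast to
`𝕜` because `H →L[𝕜] H` is only given as an algebra over `𝕜`. -/
theorem isPropagator_exp (a : H →L[𝕜] H) :
    IsPropagator ((a : H →ₗ[𝕜] H).toPMap ⊤) fun t : ℝ => NormedSpace.exp ((t : 𝕜) • (-a)) := by
  have hdense : Dense (((a : H →ₗ[𝕜] H).toPMap ⊤).domain : Set H) := by simp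
  have hadj : ∀ φ : ((a : H →ₗ[𝕜] H).toPMap ⊤).adjoint.domain,
      ((a : H →ₗ[𝕜] H).toPMap ⊤).adjoint φ = a.adjoint φ := fun φ =>
    LinearPMap.adjoint_apply_eq hdense φ fun x =>
      ContinuousLinearMap.adjoint_inner_left a _ _
  have hdom : ∀ φ, φ ∈ ((a : H →ₗ[𝕜] H).toPMap ⊤).adjoint.domain := fun φ =>
    LinearPMap.mem_adjoint_domain_of_exists φ ⟨a.adjoint φ, fun x =>
      ContinuousLinearMap.adjoint_inner_left a _ _⟩
  have hcont : Continuous fun t : ℝ => NormedSpace.exp ((t : 𝕜) • (-a)) :=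
    (continuous_iff_continuousAt.2 fun z =>
      (hasDerivAt_exp_smul_const (𝕂 := 𝕜) (-a) z).continuousAt).comp RCLike.continuous_ofReal
  refine ⟨?_, ?_, by simp; rfl, ?_, ?_, ?_⟩
  · exact (hcont.comp continuous_fst).clm_apply continuous_snd
  · exact fun T => isCompact_Icc.exists_bound_of_continuousOn hcont.continuousOn
  · intro φ x t _
    have hder : ∀ s : ℝ, HasDerivAt
        (fun s : ℝ => inner 𝕜 (φ : H) (NormedSpace.exp ((s : 𝕜) • (-a)) x))
        (-inner 𝕜 (a.adjoint φ) (NormedSpace.exp ((s : 𝕜) • (-a)) x)) s := by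
      intro s
      have h1 := hasDerivAt_exp_smul_const' (𝕂 := 𝕜) (-a) (s : 𝕜)
      have h2 := ((innerSL 𝕜 (φ : H)).comp
        (ContinuousLinearMap.apply 𝕜 H x)).hasFDerivAt.comp_hasDerivAt (s : 𝕜) h1
      have h3 := (h2.hasFDerivAt.restrictScalars ℝ).comp_hasDerivAt s
        (RCLike.ofRealCLM (K := 𝕜)).hasDerivAt
      refine HasDerivAt.congr_deriv h3 ?_
      simp [ContinuousLinearMap.adjoint_inner_left]
    have h4 := intervalIntegral.integral_eq_sub_of_hasDerivAt (a := 0) (b := t) (fun s _ => hder s)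
      (Continuous.intervalIntegrable (by
        exact (continuous_const.inner (hcont.clm_apply continuous_const)).neg) _ _)
    rw [intervalIntegral.integral_neg] at h4
    rw [hadj, sub_eq_add_neg, h4]
    simp
  · intro T w hw h
    -- All of `H` is available for testing, so the weak equation is an integral equation in `H`.
    let _ : NormedSpace ℝ H := NormedSpace.restrictScalars ℝ 𝕜 H
    have _ : IsScalarTower ℝ 𝕜 H := RestrictScalars.isScalarTower ℝ 𝕜 H
    refine eq_zero_of_eq_integral (K := ‖a‖) (g := fun s => -a (w s))
      (a.continuous.comp_continuousOn hw).neg (fun t ht => ?_)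
      (fun t _ => by rw [norm_neg]; exact a.le_opNorm _)
    refine ext_inner_left 𝕜 fun φ => ?_
    have hint : IntervalIntegrable (fun s => a (w s)) volume 0 t := by
      refine ContinuousOn.intervalIntegrable ?_
      rw [uIcc_of_le ht.1]
      exact (a.continuous.comp_continuousOn hw).mono (Icc_subset_Icc_right ht.2)
    rw [h ⟨φ, hdom φ⟩ t ht, hadj, intervalIntegral.integral_neg, inner_neg_right]
    congr 1
    rw [intervalIntegral.integral_of_le ht.1, intervalIntegral.integral_of_le ht.1,
      ← integral_inner hint.1]
    simp [ContinuousLinearMap.adjoint_inner_left]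
  · intro φ x α β _ hαβ h t _
    have han : AnalyticOnNhd ℝ
        (fun t : ℝ => inner 𝕜 φ (NormedSpace.exp ((t : 𝕜) • (-a)) x)) univ := by
      intro s _
      have h1 : AnalyticAt 𝕜 (fun z : 𝕜 => inner 𝕜 φ (NormedSpace.exp (z • (-a)) x)) (s : 𝕜) := by
        have h2 : AnalyticAt 𝕜 (fun z : 𝕜 => NormedSpace.exp (z • (-a))) (s : 𝕜) :=
          (NormedSpace.exp_analytic (𝕂 := 𝕜) ((s : 𝕜) • (-a))).comp_of_eq
            (analyticAt_id.smul analyticAt_const) rfl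
        exact (((innerSL 𝕜 φ).comp
          (ContinuousLinearMap.apply 𝕜 H x)).analyticAt _).comp h2
      exact (h1.restrictScalars (𝕜 := ℝ)).comp ((RCLike.ofRealCLM (K := 𝕜)).analyticAt s)
    refine han.eqOn_zero_of_preconnected_of_eventuallyEq_zero isPreconnected_univ
      (mem_univ ((α + β) / 2)) ?_ (mem_univ t)
    filter_upwards [Ioo_mem_nhds (show α < (α + β) / 2 by linarith)
      (show (α + β) / 2 < β by linarith)] with s hs using h s hs

end

/-! ### Propagators diagonal in a Hilbert basis -/

section

/-- An absolutely convergent Dirichlet-type series is real-analytic on `(0, ∞)`: it is the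
restriction of a series converging uniformly to a holomorphic function on the right half-plane. -/
theorem analyticOnNhd_tsum_mul_exp {ι : Type*} {μ : ι → ℝ} (hμ : ∀ i, 0 ≤ μ i) {a : ι → ℝ}
    (ha : Summable a) :
    AnalyticOnNhd ℝ (fun t => ∑' i, a i * Real.exp (-μ i * t)) (Ioi 0) := by
  have hopen : IsOpen {z : ℂ | 0 < z.re} := isOpen_lt continuous_const Complex.continuous_re
  have hdiff : DifferentiableOn ℂ (fun z : ℂ => ∑' i, (a i : ℂ) * Complex.exp (-(μ i : ℂ) * z))
      {z : ℂ | 0 < z.re} := by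
    refine Complex.differentiableOn_tsum_of_summable_norm ha.norm (fun i => by fun_prop) hopen ?_
    intro i z hz
    rw [norm_mul, Complex.norm_exp, Complex.norm_real]
    have : (-(μ i : ℂ) * z).re ≤ 0 := by
      simpa using mul_nonneg (hμ i) (le_of_lt hz)
    exact mul_le_of_le_one_right (norm_nonneg _) (Real.exp_le_one_iff.2 this)
  intro t ht
  have h1 := (hdiff.analyticOnNhd hopen (t : ℂ) (by simpa using ht)).restrictScalars (𝕜 := ℝ)
  have h2 := (Complex.reCLM.analyticAt _).comp (h1.comp (Complex.ofRealCLM.analyticAt t))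
  refine h2.congr (Eventually.of_forall fun s => ?_)
  have : ∑' i, (a i : ℂ) * Complex.exp (-(μ i : ℂ) * (s : ℂ)) =
      ((∑' i, a i * Real.exp (-μ i * s) : ℝ) : ℂ) := by
    push_cast
    rfl
  simp only [Function.comp_apply, Complex.reCLM_apply]
  rw [this, Complex.ofReal_re]

theorem tsum_mul_exp_eq_zero {ι : Type*} {μ : ι → ℝ} (hμ : ∀ i, 0 ≤ μ i) {a : ι → ℝ}
    (ha : Summable a) {α β : ℝ} (hα : 0 ≤ α) (hαβ : α < β)
    (h : ∀ t ∈ Ioo α β, ∑' i, a i * Real.exp (-μ i * t) = 0) {t : ℝ} (ht : 0 < t) :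
    ∑' i, a i * Real.exp (-μ i * t) = 0 := by
  refine (analyticOnNhd_tsum_mul_exp hμ ha).eqOn_zero_of_preconnected_of_eventuallyEq_zero
    isPreconnected_Ioi (z₀ := (α + β) / 2) (mem_Ioi.2 (by linarith)) ?_ ht
  filter_upwards [Ioo_mem_nhds (show α < (α + β) / 2 by linarith)
    (show (α + β) / 2 < β by linarith)] with s hs using h s hs

variable {𝕜 H ι : Type*} [RCLike 𝕜] [NormedAddCommGroup H] [InnerProductSpace 𝕜 H]

theorem _root_.HilbertBasis.induction_on (e : HilbertBasis ι 𝕜 H) {p : H → Prop}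
    (closed : IsClosed {x | p x}) (basis : ∀ i, p (e i)) (zero : p 0)
    (add : ∀ x y, p x → p y → p (x + y)) (smul : ∀ (c : 𝕜) x, p x → p (c • x)) (x : H) : p x := by
  have hsub : (Submodule.span 𝕜 (range e) : Set H) ⊆ {x | p x} := fun z hz =>
    Submodule.span_induction (p := fun x _ => p x) (by rintro _ ⟨i, rfl⟩; exact basis i) zero
      (fun x y _ _ => add x y) (fun c x _ => smul c x) hz
  have hx : x ∈ (Submodule.span 𝕜 (range e)).topologicalClosure := by
    rw [e.dense_span]; exact Submodule.mem_top
  exact closure_minimal hsub closed hx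

/-- The operator with eigenvectors `e i` and eigenvalues `exp (-μ i * t)`, that is
`exp (-t A)` when `A (e i) = μ i • e i`. Negative times are truncated to `0`, which keeps every
`diagonalDecay e hμ t` a contraction and the family continuous on all of `ℝ`. -/
noncomputable def diagonalDecay (e : HilbertBasis ι 𝕜 H) {μ : ι → ℝ} (hμ : ∀ i, 0 ≤ μ i) (t : ℝ) :
    H →L[𝕜] H :=
  (e.repr.symm.toContinuousLinearEquiv : _ →L[𝕜] H) ∘L
    lp.mapCLM 2 (fun i => ((Real.exp (-μ i * max t 0) : ℝ) : 𝕜) • ContinuousLinearMap.id 𝕜 𝕜)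
      zero_le_one (fun i => by
        rw [norm_smul, RCLike.norm_ofReal, abs_of_pos (Real.exp_pos _)]
        refine (mul_le_of_le_one_right (Real.exp_pos _).le ContinuousLinearMap.norm_id_le).trans ?_
        refine Real.exp_le_one_iff.2 ?_
        rw [neg_mul]
        exact neg_nonpos.2 (mul_nonneg (hμ i) (le_max_right _ _))) ∘L
    (e.repr.toContinuousLinearEquiv : H →L[𝕜] _)

section diagonalDecay

variable (e : HilbertBasis ι 𝕜 H) {μ : ι → ℝ} (hμ : ∀ i, 0 ≤ μ i)

theorem inner_diagonalDecay (t : ℝ) (x : H) (i : ι) :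
    inner 𝕜 (e i) (diagonalDecay e hμ t x) =
      (Real.exp (-μ i * max t 0) : ℝ) * inner 𝕜 (e i) x := by
  rw [← e.repr_apply_apply, ← e.repr_apply_apply]
  simp [diagonalDecay]

theorem norm_diagonalDecay_le (t : ℝ) : ‖diagonalDecay e hμ t‖ ≤ 1 := by
  refine ContinuousLinearMap.opNorm_le_bound _ zero_le_one fun x => ?_
  simp only [diagonalDecay, ContinuousLinearMap.comp_apply]
  refine (e.repr.symm.norm_map _).le.trans ?_
  refine (ContinuousLinearMap.le_of_opNorm_le _ (lp.norm_mapCLM_le _ _ _ _) _).trans ?_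
  exact (congrArg (1 * ·) (e.repr.norm_map x)).le

/- From here on only the coefficients and the norm bound matter, and unfolding the `ℓ²` model makes
unification very slow. -/
attribute [irreducible] diagonalDecay

theorem _root_.HilbertBasis.ext_inner (e : HilbertBasis ι 𝕜 H) {x y : H}
    (h : ∀ i, inner 𝕜 (e i) x = inner 𝕜 (e i) y) : x = y := by
  refine e.repr.injective (lp.ext (funext fun i => ?_))
  rw [e.repr_apply_apply, e.repr_apply_apply, h i]

theorem diagonalDecay_basis (t : ℝ) (i : ι) :
    diagonalDecay e hμ t (e i) = ((Real.exp (-μ i * max t 0) : ℝ) : 𝕜) • e i := by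
  refine e.ext_inner fun j => ?_
  rw [inner_diagonalDecay, inner_smul_right]
  rcases eq_or_ne j i with rfl | hij
  · rfl
  · rw [e.orthonormal.2 hij, mul_zero, mul_zero]

theorem continuous_diagonalDecay : Continuous fun p : ℝ × H => diagonalDecay e hμ p.1 p.2 := by
  refine continuous_prod_of_dense_continuous_lipschitzWith' _ 1
    (Submodule.dense_iff_topologicalClosure_eq_top.2 e.dense_span) (fun t => ?_) fun x hx => ?_
  · exact (diagonalDecay e hμ t).lipschitz.weaken
      (by exact_mod_cast norm_diagonalDecay_le e hμ t)
  · change Continuous fun t => diagonalDecay e hμ t x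
    induction hx using Submodule.span_induction with
    | mem x hx =>
      obtain ⟨i, rfl⟩ := hx
      simp only [diagonalDecay_basis]
      exact (RCLike.continuous_ofReal.comp (by fun_prop)).smul continuous_const
    | zero => simpa using continuous_const
    | add x y _ _ hx hy => simp only [map_add]; exact hx.add hy
    | smul c x _ hx => simp only [map_smul]; exact hx.const_smul c

theorem continuous_diagonalDecay_apply (x : H) : Continuous fun t => diagonalDecay e hμ t x :=
  Continuous.comp (g := fun p : ℝ × H => diagonalDecay e hμ p.1 p.2) (f := fun t : ℝ => (t, x))
    (continuous_diagonalDecay e hμ) (by fun_prop)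

theorem inner_diagonalDecay_eq_tsum (φ x : H) {t : ℝ} (ht : 0 ≤ t) :
    inner 𝕜 φ (diagonalDecay e hμ t x) =
      ∑' i, (inner 𝕜 φ (e i) * inner 𝕜 (e i) x) * ((Real.exp (-μ i * t) : ℝ) : 𝕜) := by
  rw [← e.tsum_inner_mul_inner]
  refine tsum_congr fun i => ?_
  rw [inner_diagonalDecay, max_eq_left ht]
  ring

theorem diagonalDecay_continuation {φ x : H} {α β : ℝ} (hα : 0 ≤ α) (hαβ : α < β)
    (h : ∀ t ∈ Ioo α β, inner 𝕜 φ (diagonalDecay e hμ t x) = 0) {t : ℝ} (ht : 0 < t) :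
    inner 𝕜 φ (diagonalDecay e hμ t x) = 0 := by
  set a : ι → 𝕜 := fun i => inner 𝕜 φ (e i) * inner 𝕜 (e i) x with ha_def
  have ha : Summable a := e.summable_inner_mul_inner φ x
  have hsum : ∀ s : ℝ, 0 ≤ s → Summable fun i => a i * ((Real.exp (-μ i * s) : ℝ) : 𝕜) := by
    intro s hs
    refine Summable.of_norm_bounded ha.norm fun i => ?_
    rw [norm_mul, RCLike.norm_ofReal, abs_of_pos (Real.exp_pos _)]
    refine mul_le_of_le_one_right (norm_nonneg _) (Real.exp_le_one_iff.2 ?_)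
    rw [neg_mul]
    exact neg_nonpos.2 (mul_nonneg (hμ i) hs)
  have hre : ∀ s : ℝ, 0 ≤ s → RCLike.re (inner 𝕜 φ (diagonalDecay e hμ s x)) =
      ∑' i, RCLike.re (a i) * Real.exp (-μ i * s) := by
    intro s hs
    rw [inner_diagonalDecay_eq_tsum e hμ φ x hs]
    refine (RCLike.reCLM (K := 𝕜)).map_tsum (hsum s hs) |>.trans (tsum_congr fun i => ?_)
    simp [ha_def]
  have him : ∀ s : ℝ, 0 ≤ s → RCLike.im (inner 𝕜 φ (diagonalDecay e hμ s x)) =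
      ∑' i, RCLike.im (a i) * Real.exp (-μ i * s) := by
    intro s hs
    rw [inner_diagonalDecay_eq_tsum e hμ φ x hs]
    refine (RCLike.imCLM (K := 𝕜)).map_tsum (hsum s hs) |>.trans (tsum_congr fun i => ?_)
    simp [ha_def]
  refine RCLike.ext ?_ ?_
  · rw [hre t ht.le, map_zero]
    refine tsum_mul_exp_eq_zero hμ ((RCLike.reCLM (K := 𝕜)).summable ha) hα hαβ (fun s hs => ?_) ht
    have := hre s (hα.trans hs.1.le)
    rw [h s hs, map_zero] at this
    exact this.symm
  · rw [him t ht.le, map_zero]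
    refine tsum_mul_exp_eq_zero hμ ((RCLike.imCLM (K := 𝕜)).summable ha) hα hαβ (fun s hs => ?_) ht
    have := him s (hα.trans hs.1.le)
    rw [h s hs, map_zero] at this
    exact this.symm

theorem integral_mul_exp_neg_mul (c t : ℝ) :
    ∫ s in (0 : ℝ)..t, c * Real.exp (-c * s) = 1 - Real.exp (-c * t) := by
  have hd : ∀ s : ℝ, HasDerivAt (fun s => -Real.exp (-c * s)) (c * Real.exp (-c * s)) s := by
    intro s
    have h := (((hasDerivAt_id s).const_mul (-c)).exp).neg
    refine h.congr_deriv ?_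
    simp [mul_comm]
  rw [intervalIntegral.integral_eq_sub_of_hasDerivAt (fun s _ => hd s)
    (Continuous.intervalIntegrable (by fun_prop) _ _)]
  simp
  ring

/-- The weak equation is linear and continuous in the initial value, so it has to be verified on the
eigenbasis only; uniqueness follows by testing with the eigenvectors. -/
theorem isPropagator_diagonalDecay [CompleteSpace H] {A : H →ₗ.[𝕜] H}
    (hdense : Dense (A.domain : Set H)) (hsymm : A.IsFormalAdjoint A)
    (heig : ∀ i, ∃ h : e i ∈ A.domain, A ⟨e i, h⟩ = (μ i : 𝕜) • e i) :
    IsPropagator A (diagonalDecay e hμ) where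
  continuous := continuous_diagonalDecay e hμ
  bounded _ := ⟨1, fun t _ => norm_diagonalDecay_le e hμ t⟩
  zero := by
    ext x
    refine e.ext_inner fun i => ?_
    simp [inner_diagonalDecay]
  weak φ x t ht := by
    have hint : ∀ (ψ x : H) (t : ℝ),
        IntervalIntegrable (fun s => inner 𝕜 ψ (diagonalDecay e hμ s x)) volume 0 t :=
      fun ψ x t =>
        (continuous_const.inner (continuous_diagonalDecay_apply e hμ x)).intervalIntegrable _ _
    refine e.induction_on (p := fun x => inner 𝕜 (φ : H) (diagonalDecay e hμ t x) =
      inner 𝕜 (φ : H) x - ∫ s in (0 : ℝ)..t, inner 𝕜 (A.adjoint φ) (diagonalDecay e hμ s x))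
      ?_ ?_ ?_ ?_ ?_ x
    · refine isClosed_eq (continuous_const.inner (diagonalDecay e hμ t).continuous)
        ((continuous_const.inner continuous_id).sub ?_)
      have hF : Continuous (Function.uncurry fun (x : H) (s : ℝ) =>
          inner 𝕜 (A.adjoint φ) (diagonalDecay e hμ s x)) := by
        exact continuous_const.inner ((continuous_diagonalDecay e hμ).comp continuous_swap)
      exact intervalIntegral.continuous_parametric_intervalIntegral_of_continuous' hF 0 t
    · intro i
      obtain ⟨hi, hAi⟩ := heig i
      have hadj : inner 𝕜 (A.adjoint φ) (e i) = (μ i : 𝕜) * inner 𝕜 (φ : H) (e i) := by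
        rw [LinearPMap.adjoint_isFormalAdjoint hdense φ ⟨e i, hi⟩, hAi, inner_smul_right]
      have hI : ∫ s in (0 : ℝ)..t, inner 𝕜 (A.adjoint φ) (diagonalDecay e hμ s (e i)) =
          ((1 - Real.exp (-μ i * t) : ℝ) : 𝕜) * inner 𝕜 (φ : H) (e i) := by
        rw [← integral_mul_exp_neg_mul, ← RCLike.intervalIntegral_ofReal,
          ← intervalIntegral.integral_mul_const]
        refine intervalIntegral.integral_congr fun s hs => ?_
        rw [uIcc_of_le ht] at hs
        simp only [diagonalDecay_basis, inner_smul_right, hadj, max_eq_left hs.1]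
        push_cast
        ring
      rw [hI, diagonalDecay_basis, inner_smul_right, max_eq_left ht]
      push_cast
      ring
    · simp
    · intro x y hx hy
      simp only [map_add, inner_add_right]
      rw [intervalIntegral.integral_add (hint _ _ _) (hint _ _ _), hx, hy]
      ring
    · intro c x hx
      simp only [map_smul, inner_smul_right]
      rw [intervalIntegral.integral_const_mul, hx]
      ring
  unique T w hw h t ht := by
    refine e.ext_inner fun i => ?_
    obtain ⟨hi, hAi⟩ := heig i
    have hform : ∀ x : A.domain, inner 𝕜 ((μ i : 𝕜) • e i) (x : H) = inner 𝕜 (e i) (A x) :=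
      fun x => by rw [← hAi]; exact hsymm ⟨e i, hi⟩ x
    have hmem : e i ∈ A.adjoint.domain := LinearPMap.mem_adjoint_domain_of_exists _ ⟨_, hform⟩
    have hadj : A.adjoint ⟨e i, hmem⟩ = (μ i : 𝕜) • e i :=
      LinearPMap.adjoint_apply_eq hdense ⟨e i, hmem⟩ hform
    rw [inner_zero_right]
    have hwi : ContinuousOn (fun s => inner 𝕜 (e i) (w s)) (Icc 0 T) := continuousOn_const.inner hw
    refine eq_zero_of_eq_integral (K := μ i) (w := fun s => inner 𝕜 (e i) (w s))
      (g := fun s => -((μ i : 𝕜) * inner 𝕜 (e i) (w s)))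
      (continuousOn_const.mul hwi).neg (fun s hs => ?_) (fun s _ => ?_) t ht
    · rw [intervalIntegral.integral_neg, h ⟨e i, hmem⟩ s hs, hadj]
      simp only [inner_smul_left, RCLike.conj_ofReal]
    · rw [norm_neg, norm_mul, RCLike.norm_ofReal, abs_of_nonneg (hμ i)]
  continuation _ _ _ _ hα hαβ h _ ht := diagonalDecay_continuation e hμ hα hαβ h ht

end diagonalDecay

end

/-! ### Operators with compact resolvent -/

section

variable {𝕜 : Type u} {H : Type v} [RCLike 𝕜] [NormedAddCommGroup H] [InnerProductSpace 𝕜 H]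

theorem IsPositiveDefinite.eq_zero {A : H →ₗ.[𝕜] H} (hA : IsPositiveDefinite A) {x : A.domain}
    (hx : (x : H) + A x = 0) : (x : H) = 0 := by
  by_contra hne
  have h1 := hA x hne
  rw [eq_neg_of_add_eq_zero_right hx, inner_neg_left, map_neg, inner_self_eq_norm_sq] at h1
  nlinarith [sq_nonneg ‖(x : H)‖]

variable [CompleteSpace H]

/-- A Hilbert basis adapted to the eigenspaces of a compact self-adjoint operator. -/
theorem _root_.IsCompactOperator.exists_hilbertBasis_eigenvectors {G : H →L[𝕜] H}
    (hG : IsCompactOperator G) (hsymm : (G : H →ₗ[𝕜] H).IsSymmetric) :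
    ∃ (ι : Type (max u v)) (e : HilbertBasis ι 𝕜 H) (γ : ι → 𝕜), ∀ i, G (e i) = γ i • e i := by
  let V : 𝕜 → Submodule 𝕜 H := fun γ => eigenspace (G : Module.End 𝕜 H) γ
  have hcl : ∀ γ, IsClosed (V γ : Set H) := fun γ => by
    have : (V γ : Set H) = {x | G x = γ • x} := by
      ext x; exact mem_eigenspace_iff
    rw [this]
    exact isClosed_eq (by fun_prop) (by fun_prop)
  have hcomplete : ∀ γ, CompleteSpace (V γ) := fun γ => (hcl γ).completeSpace_coe
  choose w b _ using fun γ => exists_hilbertBasis 𝕜 (V γ)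
  have horth : Orthonormal 𝕜 fun a : Σ γ, w γ => ((b a.1 a.2 : V a.1) : H) :=
    hsymm.orthogonalFamily_eigenspaces.orthonormal_sigma_orthonormal
      (v_family := fun γ i => b γ i) fun γ => (b γ).orthonormal
  have hbot : (Submodule.span 𝕜 (range fun a : Σ γ, w γ => ((b a.1 a.2 : V a.1) : H)))ᗮ = ⊥ := by
    rw [eq_bot_iff, ← ContinuousLinearMap.orthogonalComplement_iSup_eigenspaces_eq_bot hG hsymm]
    refine fun x hx => ?_
    rw [Submodule.mem_orthogonal'] at hx
    rw [← Submodule.iInf_orthogonal, Submodule.mem_iInf]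
    intro γ
    rw [Submodule.mem_orthogonal']
    intro z hz
    have h1 := ((b γ).hasSum_repr ⟨z, hz⟩).mapL ((innerSL 𝕜 x).comp (V γ).subtypeL)
    refine h1.unique ?_
    convert hasSum_zero with i
    have := hx _ (Submodule.subset_span ⟨⟨γ, i⟩, rfl⟩)
    simp [this]
  refine ⟨Σ γ, w γ, HilbertBasis.mkOfOrthogonalEqBot horth hbot, Sigma.fst, fun a => ?_⟩
  rw [HilbertBasis.coe_mkOfOrthogonalEqBot]
  exact mem_eigenspace_iff.1 (b a.1 a.2 : V a.1).2

/-- The point `-1` lies in the resolvent set, with compact resolvent. The given resolvent point may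
be non-real; by the Fredholm alternative, the compact resolvent moves to `-1`, where it is
symmetric. -/
theorem exists_compact_inverse_one_add {A : H →ₗ.[𝕜] H} (hpos : IsPositiveDefinite A)
    (hcomp : HasCompactResolvent A) :
    ∃ G : H →L[𝕜] H, IsCompactOperator G ∧ ∀ x, ∃ h : G x ∈ A.domain, G x + A ⟨G x, h⟩ = x := by
  obtain ⟨lam, R, ⟨hR, -⟩, hRc⟩ := hcomp
  have hadd : ∀ x, ∃ h : R x ∈ A.domain, R x + A ⟨R x, h⟩ = (1 + lam) • R x - x := fun x => by
    obtain ⟨h, hx⟩ := hR x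
    refine ⟨h, ?_⟩
    nth_rewrite 4 [← hx]
    rw [add_smul, one_smul]
    abel
  -- Thus `(1 + A) R = (1 + lam) R - 1`, and `R Q` inverts `1 + A` if `Q` inverts the right side.
  obtain ⟨Q, hQ⟩ : ∃ Q : H →L[𝕜] H, ∀ x, (1 + lam) • R (Q x) - Q x = x := by
    by_cases hc : 1 + lam = 0
    · exact ⟨-ContinuousLinearMap.id 𝕜 H, fun x => by simp [hc]⟩
    rcases hRc.hasEigenvalue_or_mem_resolventSet (inv_ne_zero hc) with h | h
    · exfalso
      obtain ⟨z, hz⟩ := h.exists_hasEigenvector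
      have hRz : R z = (1 + lam)⁻¹ • z := hz.apply_eq_smul
      obtain ⟨hm, hz'⟩ := hadd z
      have h0 : (1 + lam) • R z - z = 0 := by rw [hRz, smul_inv_smul₀ hc, sub_self]
      have hRz0 : R z = 0 := hpos.eq_zero (x := ⟨R z, hm⟩) (hz'.trans h0)
      rw [hRz] at hRz0
      exact hz.2 ((smul_eq_zero.1 hRz0).resolve_left (inv_ne_zero hc))
    · obtain ⟨q, hq⟩ := (spectrum.mem_resolventSet_iff.1 h).exists_right_inv
      refine ⟨-(1 + lam)⁻¹ • q, fun x => ?_⟩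
      have hx : (1 + lam)⁻¹ • q x - R (q x) = x := by
        simpa [Algebra.algebraMap_eq_smul_one] using congrArg (fun L : H →L[𝕜] H => L x) hq
      refine Eq.trans ?_ hx
      simp only [neg_smul, smul_neg, map_neg, map_smul, FunLike.coe_neg, FunLike.coe_smul,
        Pi.neg_apply, Pi.smul_apply, smul_inv_smul₀ hc]
      abel
  refine ⟨R ∘L Q, hRc.comp_clm Q, fun x => ?_⟩
  obtain ⟨h, hx⟩ := hadd (Q x)
  exact ⟨h, hx.trans (hQ x)⟩

theorem exists_hilbertBasis_eigenvectors {A : H →ₗ.[𝕜] H} (hsymm : A.IsFormalAdjoint A)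
    (hpos : IsPositiveDefinite A) (hcomp : HasCompactResolvent A) :
    ∃ (ι : Type (max u v)) (e : HilbertBasis ι 𝕜 H) (μ : ι → ℝ), (∀ i, 0 ≤ μ i) ∧
      ∀ i, ∃ h : e i ∈ A.domain, A ⟨e i, h⟩ = (μ i : 𝕜) • e i := by
  obtain ⟨G, hGc, hG⟩ := exists_compact_inverse_one_add hpos hcomp
  choose hmem hGA using hG
  have hGsymm : (G : H →ₗ[𝕜] H).IsSymmetric := by
    intro x y
    change inner 𝕜 (G x) y = inner 𝕜 x (G y)
    conv_lhs => rw [← hGA y]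
    conv_rhs => rw [← hGA x]
    rw [inner_add_left, inner_add_right, hsymm ⟨G x, hmem x⟩ ⟨G y, hmem y⟩]
  obtain ⟨ι, e, γ, hγ⟩ := hGc.exists_hilbertBasis_eigenvectors hGsymm
  have hne : ∀ i, e i ≠ 0 := fun i => e.orthonormal.ne_zero i
  have hγ0 : ∀ i, γ i ≠ 0 := fun i h => hne i <| by
    have h0 : G (e i) = 0 := by rw [hγ, h, zero_smul]
    have h1 : (⟨G (e i), hmem (e i)⟩ : A.domain) = 0 := Subtype.ext h0
    rw [← hGA (e i), h1, LinearPMap.map_zero, h0, add_zero]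
  have hdom : ∀ i, e i ∈ A.domain := fun i => by
    have := A.domain.smul_mem (γ i)⁻¹ (hmem (e i))
    rwa [hγ, inv_smul_smul₀ (hγ0 i)] at this
  have hA : ∀ i, A ⟨e i, hdom i⟩ = ((γ i)⁻¹ - 1) • e i := fun i => by
    have h1 : (⟨G (e i), hmem (e i)⟩ : A.domain) = γ i • ⟨e i, hdom i⟩ := Subtype.ext (hγ i)
    have h2 := hGA (e i)
    rw [h1, hγ, A.map_smul, ← smul_add] at h2
    rw [sub_smul, one_smul, eq_sub_iff_add_eq', eq_inv_smul_iff₀ (hγ0 i)]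
    exact h2
  have hreal : ∀ i, (RCLike.re ((γ i)⁻¹ - 1) : 𝕜) = (γ i)⁻¹ - 1 := fun i => by
    refine RCLike.conj_eq_iff_re.1 ?_
    have h := hsymm ⟨e i, hdom i⟩ ⟨e i, hdom i⟩
    rw [hA, inner_smul_left, inner_smul_right] at h
    exact mul_right_cancel₀ (inner_self_ne_zero.2 (hne i)) h
  refine ⟨ι, e, fun i => RCLike.re ((γ i)⁻¹ - 1), fun i => ?_, fun i => ⟨hdom i, ?_⟩⟩
  · have h := hpos ⟨e i, hdom i⟩ (hne i)
    rw [hA, inner_smul_left, inner_self_eq_norm_sq_to_K, e.orthonormal.1 i] at h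
    simpa using h.le
  · rw [hreal]
    exact hA i

theorem exists_isPropagator {A : H →ₗ.[𝕜] H}
    (hA : (IsSelfAdjoint A ∧ IsPositiveDefinite A ∧ HasCompactResolvent A) ∨
      (FiniteDimensional 𝕜 H ∧ A.domain = ⊤)) :
    ∃ S : ℝ → H →L[𝕜] H, IsPropagator A S := by
  rcases hA with ⟨hsa, hpos, hcomp⟩ | ⟨hfin, htop⟩
  · have hsymm : A.IsFormalAdjoint A := by
      have h := LinearPMap.adjoint_isFormalAdjoint hsa.dense_domain
      rwa [LinearPMap.isSelfAdjoint_def.1 hsa] at h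
    obtain ⟨ι, e, μ, hμ, heig⟩ := exists_hilbertBasis_eigenvectors hsymm hpos hcomp
    exact ⟨_, isPropagator_diagonalDecay e hμ hsa.dense_domain hsymm heig⟩
  · let a : H →L[𝕜] H := LinearMap.toContinuousLinearMap
      (A.toFun ∘ₗ (LinearEquiv.ofTop A.domain htop).symm.toLinearMap)
    have hAa : A = (a : H →ₗ[𝕜] H).toPMap ⊤ := LinearPMap.ext htop fun x h₁ h₂ => rfl
    rw [hAa]
    exact ⟨_, isPropagator_exp a⟩

end

end SwitchingControl

theorem theorem6p1 {𝕜 H U U₁ U₂ : Type*} [RCLike 𝕜]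
    [NormedAddCommGroup H] [InnerProductSpace 𝕜 H] [CompleteSpace H]
    [NormedAddCommGroup U] [InnerProductSpace 𝕜 U] [CompleteSpace U]
    [NormedAddCommGroup U₁] [InnerProductSpace 𝕜 U₁] [CompleteSpace U₁]
    [NormedAddCommGroup U₂] [InnerProductSpace 𝕜 U₂] [CompleteSpace U₂]
    (A : H →ₗ.[𝕜] H)
    (hA : (IsSelfAdjoint A ∧ SwitchingControl.IsPositiveDefinite A ∧
        SwitchingControl.HasCompactResolvent A) ∨
      (FiniteDimensional 𝕜 H ∧ A.domain = ⊤))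
    (B : U →L[𝕜] H) (π : (U₁ × U₂) ≃ₗ[𝕜] U)
    (B₁ : U₁ →L[𝕜] H) (B₂ : U₂ →L[𝕜] H)
    (hB : ∀ (u₁ : U₁) (u₂ : U₂), B (π (u₁, u₂)) = B₁ u₁ + B₂ u₂)
    (T : ℝ) (hT : 0 < T)
    (hcontr : SwitchingControl.IsApproxControllable A B T) :
    ∀ ε : ℝ, 0 < ε → ∀ y₀ : H, ∃ (u₁ : ℝ → U₁) (u₂ : ℝ → U₂),
      SwitchingControl.IsL2Control T u₁ ∧ SwitchingControl.IsL2Control T u₂ ∧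
      (∀ᵐ t ∂(volume.restrict (Set.Ioo 0 T)), ‖u₁ t‖ * ‖u₂ t‖ = 0) ∧
      (∃ y : ℝ → H,
        SwitchingControl.IsSolution A T (fun t => B₁ (u₁ t) + B₂ (u₂ t)) y₀ y) ∧
      (∀ y : ℝ → H,
        SwitchingControl.IsSolution A T (fun t => B₁ (u₁ t) + B₂ (u₂ t)) y₀ y →
          ‖y T‖ ≤ ε) := by
  intro ε hε y₀
  let _ : NormedSpace ℝ H := NormedSpace.restrictScalars ℝ 𝕜 H
  obtain ⟨S, hS⟩ := SwitchingControl.exists_isPropagator hA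
  have hB' : ∀ u : U, ∃ u₁ u₂, B u = B₁ u₁ + B₂ u₂ := fun u =>
    ⟨(π.symm u).1, (π.symm u).2, by rw [← hB, Prod.mk.eta, π.apply_symm_apply]⟩
  obtain ⟨u₁, u₂, hu₁, hu₂, hsw, hex, hall⟩ := hS.exists_switching_controls hB' hT hcontr hε y₀
  exact ⟨u₁, u₂, hu₁, hu₂, Filter.Eventually.of_forall hsw, hex, hall⟩
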